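/- An \emph{$\mathsf{S4}$-algebra} is a Boolean algebra $B$ with a unary operation $\lozenge$ satisfying $\lozenge 0=0$, $\lozenge(a\vee b)=\lozenge a\vee\lozenge b$, $a\le\lozenge a$ and $\lozenge\lozenge a\le\lozenge a$; put $\square a=-\lozenge{-}a$. An \emph{$\mathsf{MS4}$-algebra} is a triple $\mathfrak A=(B,\lozenge,\exists)$ such that $(B,\lozenge)$ and $(B,\exists)$ are $\mathsf{S4}$-algebras, $\exists\forall a\le\forall a$ where $\forall a=-\exists{-}a$, and $\exists\lozenge a\le\lozenge\exists a$. Let $\mathfrak A_0$ be the set $\{a\in B:\exists a=a\}$, regarded as an $\mathsf{S4}$-algebra under the restrictions of the Boolean operations and of $\lozenge$; it is a subalgebra of $(B,\lozenge)$. Let $\mathbf{MS4}$ be the variety of all $\mathsf{MS4}$-algebras. Define formulas $P_n$ for $n\ge 1$ by $$P_1=\lozenge\square q_1\to\square q_1,\qquad P_n=\lozenge(\square q_n\wedge\neg P_{n-1})\to\square q_n\quad(n\ge 2).$$ For a class $\mathbf V$ of $\mathsf{MS4}$-algebras, write $\mathbf V\models P_k$ if $P_k$ takes the value $1$ in every member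 of $\mathbf V$ under every assignment of the variables. An algebra is \emph{$n$-generated} if it is generated by some $n$-tuple of its elements (repetitions allowed). It is \emph{subdirectly irreducible} if it has a least congruence among the congruences other than the identity. A variety is \emph{locally finite} if every finitely generated subalgebra of each of its members is finite. \textbf{Theorem.} Let $\mathbf V$ be a subvariety of $\mathbf{MS4}$, i.e. a class of $\mathsf{MS4}$-algebras closed under homomorphic images, subalgebras and direct products. Then $\mathbf V$ is locally finite if and only if both of the following hold: \begin{enumerate} \item $\mathbf V$ is of finite depth, i.e. $\mathbf V\models P_k$ for some $k\ge 1$; \item there is a function $f:\omega\to\omega$ such that for every $n\in\omega$ and every $n$-generated subdirectly irreducible $\mathfrak A\in\mathbf V$, the algebra $\mathfrak A_0$ is $f(n)$-generated as an $\mathsf{S4}$-algebra. \end{enumerate} -/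

import Mathlib

universe u

/-- An `S4`-algebra: a Boolean algebra with a closure operator `dia` (written `◇`). -/
class S4Algebra (B : Type u) extends BooleanAlgebra B where
  dia : B → B
  dia_bot : dia ⊥ = ⊥
  dia_sup : ∀ a b : B, dia (a ⊔ b) = dia a ⊔ dia b
  le_dia : ∀ a : B, a ≤ dia a
  dia_dia_le : ∀ a : B, dia (dia a) ≤ dia a

/-- An `MS4`-algebra: an `S4`-algebra `(B, ◇)` together with an `S5`-operator `ex`
(written `∃`, with dual `∀ a = -∃-a`) such that `∃◇a ≤ ◇∃a`. -/
class MS4Algebra (B : Type u) extends S4Algebra B where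
  ex : B → B
  ex_bot : ex ⊥ = ⊥
  ex_sup : ∀ a b : B, ex (a ⊔ b) = ex a ⊔ ex b
  le_ex : ∀ a : B, a ≤ ex a
  ex_ex_le : ∀ a : B, ex (ex a) ≤ ex a
  ex_all_le : ∀ a : B, ex (ex aᶜ)ᶜ ≤ (ex aᶜ)ᶜ
  ex_dia_le : ∀ a : B, ex (dia a) ≤ dia (ex a)

/-! ### `S4`-subalgebras and generation of `S4`-algebras -/

/-- A subalgebra of an `S4`-algebra. -/
structure S4Subalgebra (B : Type u) [S4Algebra B] extends BooleanSubalgebra B where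
  dia_mem' : ∀ {a : B}, a ∈ carrier → S4Algebra.dia a ∈ carrier

namespace S4Subalgebra

variable {B : Type u} [S4Algebra B]

instance : SetLike (S4Subalgebra B) B where
  coe S := S.carrier
  coe_injective S T h := by
    obtain ⟨S, _⟩ := S
    obtain ⟨T, _⟩ := T
    have : S = T := SetLike.coe_injective h
    subst this
    rfl

/-- A subalgebra is an `S4`-algebra under the restricted operations. -/
instance instS4AlgebraCoe (S : S4Subalgebra B) : S4Algebra S :=
  { (BooleanSubalgebra.instBooleanAlgebraCoe S.toBooleanSubalgebra : BooleanAlgebra S) with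
    dia := fun a => ⟨S4Algebra.dia a.1, S.dia_mem' a.2⟩
    dia_bot := Subtype.ext S4Algebra.dia_bot
    dia_sup := fun a b => Subtype.ext (S4Algebra.dia_sup a.1 b.1)
    le_dia := fun a => S4Algebra.le_dia a.1
    dia_dia_le := fun a => S4Algebra.dia_dia_le a.1 }

/-- The subalgebra generated by a set. -/
def closure (s : Set B) : S4Subalgebra B where
  carrier := {a | ∀ S : S4Subalgebra B, s ⊆ (S : Set B) → a ∈ S}
  supClosed' _ ha _ hb S hS := S.supClosed' (ha S hS) (hb S hS)
  infClosed' _ ha _ hb S hS := S.infClosed' (ha S hS) (hb S hS)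
  compl_mem' ha S hS := S.compl_mem' (ha S hS)
  bot_mem' S _ := S.bot_mem'
  dia_mem' ha S hS := S.dia_mem' (ha S hS)

end S4Subalgebra

/-- The `S4`-algebra `B` is generated by (at most) `n` elements. -/
def S4Algebra.IsGeneratedBy (B : Type u) [S4Algebra B] (n : ℕ) : Prop :=
  ∃ g : Fin n → B, ∀ a : B, a ∈ S4Subalgebra.closure (Set.range g)

/-! ### Subalgebras, homomorphisms, products and congruences of `MS4`-algebras -/

/-- A subalgebra of an `MS4`-algebra. -/
structure MS4Subalgebra (B : Type u) [MS4Algebra B] extends S4Subalgebra B where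
  ex_mem' : ∀ {a : B}, a ∈ carrier → MS4Algebra.ex a ∈ carrier

namespace MS4Subalgebra

variable {B : Type u} [MS4Algebra B]

instance : SetLike (MS4Subalgebra B) B where
  coe S := S.carrier
  coe_injective S T h := by
    obtain ⟨S, _⟩ := S
    obtain ⟨T, _⟩ := T
    have : S = T := SetLike.coe_injective h
    subst this
    rfl

/-- A subalgebra is an `MS4`-algebra under the restricted operations. -/
instance instMS4AlgebraCoe (S : MS4Subalgebra B) : MS4Algebra S :=
  { (S4Subalgebra.instS4AlgebraCoe S.toS4Subalgebra : S4Algebra S) with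
    ex := fun a => ⟨MS4Algebra.ex a.1, S.ex_mem' a.2⟩
    ex_bot := Subtype.ext MS4Algebra.ex_bot
    ex_sup := fun a b => Subtype.ext (MS4Algebra.ex_sup a.1 b.1)
    le_ex := fun a => MS4Algebra.le_ex a.1
    ex_ex_le := fun a => MS4Algebra.ex_ex_le a.1
    ex_all_le := fun a => MS4Algebra.ex_all_le a.1
    ex_dia_le := fun a => MS4Algebra.ex_dia_le a.1 }

/-- The subalgebra generated by a set. -/
def closure (s : Set B) : MS4Subalgebra B where
  carrier := {a | ∀ S : MS4Subalgebra B, s ⊆ (S : Set B) → a ∈ S}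
  supClosed' _ ha _ hb S hS := S.supClosed' (ha S hS) (hb S hS)
  infClosed' _ ha _ hb S hS := S.infClosed' (ha S hS) (hb S hS)
  compl_mem' ha S hS := S.compl_mem' (ha S hS)
  bot_mem' S _ := S.bot_mem'
  dia_mem' ha S hS := S.dia_mem' (ha S hS)
  ex_mem' ha S hS := S.ex_mem' (ha S hS)

end MS4Subalgebra

/-- A homomorphism of `MS4`-algebras (complements are preserved automatically). -/
structure MS4Hom (A B : Type u) [MS4Algebra A] [MS4Algebra B] extends
    BoundedLatticeHom A B where
  map_dia' : ∀ a : A, toFun (S4Algebra.dia a) = S4Algebra.dia (toFun a)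
  map_ex' : ∀ a : A, toFun (MS4Algebra.ex a) = MS4Algebra.ex (toFun a)

/-- The direct product of `MS4`-algebras, with pointwise operations. -/
instance MS4Algebra.pi {I : Type u} (A : I → Type u) [∀ i, MS4Algebra (A i)] :
    MS4Algebra (∀ i, A i) :=
  { (Pi.instBooleanAlgebra : BooleanAlgebra (∀ i, A i)) with
    dia := fun a i => S4Algebra.dia (a i)
    dia_bot := funext fun _ => S4Algebra.dia_bot
    dia_sup := fun a b => funext fun i => S4Algebra.dia_sup (a i) (b i)
    le_dia := fun a i => S4Algebra.le_dia (a i)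
    dia_dia_le := fun a i => S4Algebra.dia_dia_le (a i)
    ex := fun a i => MS4Algebra.ex (a i)
    ex_bot := funext fun _ => MS4Algebra.ex_bot
    ex_sup := fun a b => funext fun i => MS4Algebra.ex_sup (a i) (b i)
    le_ex := fun a i => MS4Algebra.le_ex (a i)
    ex_ex_le := fun a i => MS4Algebra.ex_ex_le (a i)
    ex_all_le := fun a i => MS4Algebra.ex_all_le (a i)
    ex_dia_le := fun a i => MS4Algebra.ex_dia_le (a i) }

/-- A congruence of an `MS4`-algebra: an equivalence relation compatible with all operations. -/
structure MS4Congruence (A : Type u) [MS4Algebra A] extends Setoid A where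
  sup' : ∀ {a b c d : A}, r a b → r c d → r (a ⊔ c) (b ⊔ d)
  inf' : ∀ {a b c d : A}, r a b → r c d → r (a ⊓ c) (b ⊓ d)
  compl' : ∀ {a b : A}, r a b → r aᶜ bᶜ
  dia' : ∀ {a b : A}, r a b → r (S4Algebra.dia a) (S4Algebra.dia b)
  ex' : ∀ {a b : A}, r a b → r (MS4Algebra.ex a) (MS4Algebra.ex b)

namespace MS4Algebra

/-- `A` is subdirectly irreducible: among the congruences of `A` other than the identity
relation there is a least one. -/
def IsSubdirectlyIrreducible (A : Type u) [MS4Algebra A] : Prop :=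
  ∃ m : MS4Congruence A, m.toSetoid ≠ ⊥ ∧
    ∀ c : MS4Congruence A, c.toSetoid ≠ ⊥ → m.toSetoid ≤ c.toSetoid

/-- The `MS4`-algebra `A` is generated by (at most) `n` elements. -/
def IsGeneratedBy (A : Type u) [MS4Algebra A] (n : ℕ) : Prop :=
  ∃ g : Fin n → A, ∀ a : A, a ∈ MS4Subalgebra.closure (Set.range g)

/-- Every finitely generated subalgebra of `A` is finite. -/
def IsLocallyFinite (A : Type u) [MS4Algebra A] : Prop :=
  ∀ s : Set A, s.Finite → (MS4Subalgebra.closure s : Set A).Finite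

/-- The `S4`-algebra `A₀` of `∃`-fixpoints of an `MS4`-algebra `A`, a subalgebra of the
`S4`-reduct of `A`. -/
def exFixpoints (A : Type u) [MS4Algebra A] : S4Subalgebra A where
  carrier := {a | ex a = a}
  supClosed' a ha b hb := by
    change ex (a ⊔ b) = a ⊔ b
    rw [ex_sup, show ex a = a from ha, show ex b = b from hb]
  infClosed' a ha b hb := by
    have mono : ∀ {x y : A}, x ≤ y → ex x ≤ ex y := fun {x y} h => by
      have h1 := ex_sup x y
      rw [sup_eq_right.mpr h] at h1
      rw [h1]
      exact le_sup_left
    refine le_antisymm (le_inf ?_ ?_) (le_ex _)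
    · exact (mono inf_le_left).trans (le_of_eq ha)
    · exact (mono inf_le_right).trans (le_of_eq hb)
  compl_mem' {a} ha := by
    have h := ex_all_le aᶜ
    rw [compl_compl, show ex a = a from ha] at h
    exact le_antisymm h (le_ex _)
  bot_mem' := ex_bot
  dia_mem' {a} ha := by
    have h := ex_dia_le a
    rw [show ex a = a from ha] at h
    exact le_antisymm h (le_ex _)

end MS4Algebra

/-! ### Depth -/

/-- The necessity operator `□ a = -◇-a`. -/
def S4Algebra.box {B : Type u} [S4Algebra B] (a : B) : B := (S4Algebra.dia aᶜ)ᶜ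

/-- The value of the formula `P_(n+1)` under the valuation `q`, where
`P_1 = ◇□q_1 → □q_1` and `P_n = ◇(□q_n ∧ ¬P_(n-1)) → □q_n`. -/
def S4Algebra.depthFormula {B : Type u} [S4Algebra B] (q : ℕ → B) : ℕ → B
  | 0 => S4Algebra.dia (S4Algebra.box (q 1)) ⇨ S4Algebra.box (q 1)
  | n + 1 => S4Algebra.dia (S4Algebra.box (q (n + 2)) ⊓ (S4Algebra.depthFormula q n)ᶜ) ⇨
      S4Algebra.box (q (n + 2))

/-- `B ⊨ P_(n+1)`. -/
def S4Algebra.ValidatesDepth (B : Type u) [S4Algebra B] (n : ℕ) : Prop :=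
  ∀ q : ℕ → B, S4Algebra.depthFormula q n = ⊤

/-! ### Varieties of `MS4`-algebras -/

/-- A variety of `MS4`-algebras (a subvariety of the variety of all `MS4`-algebras): a class of
`MS4`-algebras closed under homomorphic images, subalgebras and arbitrary direct products
(the empty product included). -/
structure MS4Variety where
  Mem : ∀ (A : Type u) [MS4Algebra A], Prop
  image : ∀ (A B : Type u) [MS4Algebra A] [MS4Algebra B] (f : MS4Hom A B),
    Function.Surjective f.toFun → Mem A → Mem B
  sub : ∀ (A : Type u) [MS4Algebra A] (S : MS4Subalgebra A), Mem A → Mem S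
  prod : ∀ (I : Type u) (A : I → Type u) [∀ i, MS4Algebra (A i)],
    (∀ i, Mem (A i)) → Mem (∀ i, A i)

namespace MS4Variety

/-- Every member of `V` is a locally finite algebra. -/
def IsLocallyFinite (V : MS4Variety.{u}) : Prop :=
  ∀ (A : Type u) [MS4Algebra A], V.Mem A → MS4Algebra.IsLocallyFinite A

/-- `V ⊨ P_k` for some `k ≥ 1`. -/
def HasFiniteDepth (V : MS4Variety.{u}) : Prop :=
  ∃ k : ℕ, ∀ (A : Type u) [MS4Algebra A], V.Mem A → S4Algebra.ValidatesDepth A k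

end MS4Variety

/-! If all members have bounded depth, the Segerberg–Maksimova theorem bounds the size of an
`S4`-algebra by its number of generators (`finite_and_card_le_of_validatesDepth`). For a subdirectly
irreducible `n`-generated `A`, the algebra `A₀` inherits the depth bound and is `f n`-generated, so
its size is bounded. Every value of `∃` lies in `A₀`, so the `n` generators together with the
elements of `A₀` generate `A` as an `S4`-algebra, and the theorem applies again. A finitely
generated algebra whose subdirectly irreducible quotients have bounded size is finite: Birkhoff's
theorem separates its elements by finitely many homomorphisms.

Conversely, local finiteness bounds the size of `n`-generated members uniformly, by passing to a
product, so the elements of `A₀` can serve as its generators. It also forces finite depth: refuting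
`P_(k+1)` gives a single element whose `alternatingBox` sequence is strict for `k + 1` steps. A
product of such refutations for all `k` has a one-generated infinite subalgebra. -/

namespace S4Algebra

/-! ### One-generated sequences that detect failure of bounded depth -/

section Basic

variable {B : Type u} [S4Algebra B]

theorem dia_mono {a b : B} (h : a ≤ b) : dia a ≤ dia b := by
  have := dia_sup a b
  rw [sup_eq_right.mpr h] at this
  rw [this]
  exact le_sup_left

theorem dia_dia (a : B) : dia (dia a) = dia a := le_antisymm (dia_dia_le a) (le_dia _)

theorem box_le (a : B) : box a ≤ a := compl_le_of_compl_le (le_dia _)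

theorem dia_compl_box (a : B) : dia (box a)ᶜ = (box a)ᶜ := by
  rw [box, compl_compl, dia_dia]

theorem le_box {u a : B} (hu : dia uᶜ ≤ uᶜ) (h : u ≤ a) : u ≤ box a :=
  le_compl_comm.mp ((dia_mono (compl_le_compl h)).trans hu)

/-- The alternating element: `a` for even `n` and `aᶜ` for odd `n`. -/
def parityElement (a : B) (n : ℕ) : B := if Even n then a else aᶜ

theorem parityElement_succ (a : B) (n : ℕ) :
    parityElement a (n + 1) = (parityElement a n)ᶜ := by
  by_cases h : Even n <;> simp [parityElement, h, Nat.even_add_one]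

/-- The increasing sequence of open elements obtained from `a` by iterating
`d ↦ □(d ∨ a)` and `d ↦ □(d ∨ ¬a)` alternately. -/
def alternatingBox (a : B) : ℕ → B
  | 0 => ⊥
  | n + 1 => box (alternatingBox a n ⊔ parityElement a n)

theorem dia_compl_alternatingBox (a : B) (n : ℕ) :
    dia (alternatingBox a n)ᶜ ≤ (alternatingBox a n)ᶜ := by
  cases n with
  | zero => simp [alternatingBox]
  | succ n => exact (dia_compl_box _).le

theorem alternatingBox_monotone (a : B) : Monotone (alternatingBox a) :=
  monotone_nat_of_le_succ fun n => le_box (dia_compl_alternatingBox a n) le_sup_left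

/-- The refutation element `¬P_n` of the depth formulas, with `refutation q 0 = ⊤`. -/
def refutation (q : ℕ → B) : ℕ → B
  | 0 => ⊤
  | n + 1 => dia (box (q (n + 1)) ⊓ refutation q n) ⊓ (box (q (n + 1)))ᶜ

theorem compl_depthFormula (q : ℕ → B) (n : ℕ) :
    (depthFormula q n)ᶜ = refutation q (n + 1) := by
  induction n with
  | zero => simp [depthFormula, refutation, himp_eq, inf_comm]
  | succ n ih =>
    rw [depthFormula, ih, refutation, himp_eq, compl_sup, compl_compl, inf_comm]
    rfl

/-- The join of the first `n` opens `□q_1, …, □q_n`. -/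
def openJoin (q : ℕ → B) : ℕ → B
  | 0 => ⊥
  | n + 1 => openJoin q n ⊔ box (q (n + 1))

theorem openJoin_monotone (q : ℕ → B) : Monotone (openJoin q) :=
  monotone_nat_of_le_succ fun _ => le_sup_left

theorem dia_compl_openJoin (q : ℕ → B) (n : ℕ) : dia (openJoin q n)ᶜ ≤ (openJoin q n)ᶜ := by
  induction n with
  | zero => simp [openJoin]
  | succ n ih =>
    rw [openJoin, compl_sup]
    refine le_inf ((dia_mono inf_le_left).trans ih) ((dia_mono inf_le_right).trans ?_)
    rw [dia_compl_box]

theorem refutation_le_compl_openJoin (q : ℕ → B) (n : ℕ) :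
    refutation q n ≤ (openJoin q n)ᶜ := by
  induction n with
  | zero => simp [openJoin]
  | succ n ih =>
    rw [openJoin, compl_sup, refutation]
    refine le_inf (inf_le_left.trans ?_) inf_le_right
    exact (dia_mono (inf_le_right.trans ih)).trans (dia_compl_openJoin q n)

/-- The union of every second layer of the chain `openJoin q`. -/
def evenLayers (q : ℕ → B) : ℕ → B
  | 0 => ⊥
  | n + 1 => if Even n then evenLayers q n ⊔ openJoin q (n + 1) \ openJoin q n else evenLayers q n

theorem evenLayers_le (q : ℕ → B) (n : ℕ) : evenLayers q n ≤ openJoin q n := by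
  induction n with
  | zero => exact bot_le
  | succ n ih =>
    have h := openJoin_monotone q n.le_succ
    rw [evenLayers]
    split_ifs
    · exact sup_le (ih.trans h) sdiff_le
    · exact ih.trans h

/-- Distinct layers are disjoint, so layers added after stage `n + 1` cannot spoil the parity
already correct on layer `n`. -/
theorem layer_le_parityElement (q : ℕ → B) {n m : ℕ} (h : n < m) :
    openJoin q (n + 1) \ openJoin q n ≤ parityElement (evenLayers q m) n := by
  induction m, h using Nat.le_induction with
  | base =>
    by_cases hn : Even n
    · simp only [parityElement, evenLayers, hn, if_true]
      exact le_sup_right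
    · simp only [parityElement, evenLayers, hn, if_false]
      rw [sdiff_eq]
      exact inf_le_right.trans (compl_le_compl (evenLayers_le q n))
  | succ m hm ih =>
    rw [evenLayers]
    split_ifs with hm'
    · by_cases hn : Even n
      · simp only [parityElement, hn, if_true] at ih ⊢
        exact ih.trans le_sup_left
      · simp only [parityElement, hn, if_false] at ih ⊢
        rw [compl_sup]
        refine le_inf ih ?_
        rw [sdiff_eq, sdiff_eq, compl_inf, compl_compl]
        exact inf_le_left.trans ((openJoin_monotone q hm).trans le_sup_right)
    · exact ih

/-- The open `openJoin q (n + 1)` is covered by `openJoin q n` and layer `n`, and the latter has the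
parity used at step `n`. -/
theorem openJoin_le_alternatingBox (q : ℕ → B) {n m : ℕ} (h : n ≤ m) :
    openJoin q n ≤ alternatingBox (evenLayers q m) n := by
  induction n with
  | zero => exact bot_le
  | succ n ih =>
    refine le_box (dia_compl_openJoin q _) ?_
    have h1 := layer_le_parityElement q (Nat.lt_of_succ_le h)
    rw [sdiff_le_iff] at h1
    exact h1.trans (sup_le_sup_right (ih (by omega)) _)

/-- A point here in layer `n + 1` sees a point outside the open `alternatingBox n`, hence is outside
it too. It also has the wrong parity for step `n`, so it does not enter at stage `n + 1`. -/
theorem refutation_layer_le (q : ℕ → B) {n m : ℕ} (h : n < m) :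
    openJoin q (n + 1) ⊓ refutation q n ≤ (alternatingBox (evenLayers q m) n)ᶜ := by
  induction n with
  | zero => simp [alternatingBox]
  | succ n ih =>
    have h1 : refutation q (n + 1) ≤ (alternatingBox (evenLayers q m) n)ᶜ := by
      refine inf_le_left.trans ((dia_mono ?_).trans (dia_compl_alternatingBox _ _))
      exact (inf_le_inf_right _ le_sup_right).trans (ih (by omega))
    have h2 : openJoin q (n + 2) ⊓ refutation q (n + 1) ≤
        (parityElement (evenLayers q m) n)ᶜ := by
      rw [← parityElement_succ]
      refine le_trans ?_ (layer_le_parityElement q h)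
      rw [sdiff_eq]
      exact inf_le_inf_left _ (refutation_le_compl_openJoin q _)
    refine le_trans ?_ (compl_le_compl (box_le _))
    rw [compl_sup]
    exact le_inf (inf_le_right.trans h1) h2

theorem refutation_ne_bot_of_le (q : ℕ → B) {n m : ℕ} (h : n ≤ m) (hm : refutation q m ≠ ⊥) :
    refutation q n ≠ ⊥ := by
  induction m, h using Nat.le_induction with
  | base => exact hm
  | succ m _ ih =>
    refine ih fun h0 => hm ?_
    simp [refutation, h0, dia_bot]

/-- An algebra refuting `P_(k+1)` has an element whose alternating sequence makes at least
`k + 1` strict steps. -/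
theorem exists_alternatingBox_ne {k : ℕ} (h : ¬ ValidatesDepth B k) :
    ∃ a : B, ∀ n ≤ k, alternatingBox a n ≠ alternatingBox a (n + 1) := by
  obtain ⟨q, hq⟩ := not_forall.mp h
  have hk : refutation q (k + 1) ≠ ⊥ := by
    rw [← compl_depthFormula]
    simpa using hq
  refine ⟨evenLayers q (k + 1), fun n hn he => ?_⟩
  have h1 : refutation q (n + 1) ≠ ⊥ := refutation_ne_bot_of_le q (by omega) hk
  apply h1
  have h2 := refutation_layer_le q (n := n) (m := k + 1) (by omega)
  have h3 := openJoin_le_alternatingBox q (n := n + 1) (m := k + 1) (by omega)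
  rw [← he] at h3
  -- If the sequence stalled at `n`, the part of layer `n` where `refutation q n` holds would lie
  -- both inside and outside the same open element.
  have h4 : openJoin q (n + 1) ⊓ refutation q n = ⊥ :=
    le_bot_iff.mp ((le_inf (inf_le_left.trans h3) h2).trans_eq (inf_compl_self _))
  have h5 : box (q (n + 1)) ⊓ refutation q n = ⊥ :=
    le_bot_iff.mp ((inf_le_inf_right _ le_sup_right).trans_eq h4)
  simp [refutation, h5, dia_bot]

end Basic

end S4Algebra

/-! ### Duality, depth and types of points: the Segerberg–Maksimova theorem -/

namespace S4Algebra

/-- A point of the dual space of `B`: a prime filter. -/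
@[ext]
structure Point (B : Type u) [S4Algebra B] where
  carrier : Set B
  compl_mem : ∀ a, aᶜ ∈ carrier ↔ a ∉ carrier
  sup_mem : ∀ a b, a ⊔ b ∈ carrier ↔ a ∈ carrier ∨ b ∈ carrier

namespace Point

variable {B : Type u} [S4Algebra B]

theorem inf_mem (x : Point B) (a b : B) : a ⊓ b ∈ x.carrier ↔ a ∈ x.carrier ∧ b ∈ x.carrier := by
  have h := x.compl_mem (aᶜ ⊔ bᶜ)
  rw [compl_sup, compl_compl, compl_compl, x.sup_mem, x.compl_mem, x.compl_mem] at h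
  tauto

theorem mem_of_le (x : Point B) {a b : B} (h : a ≤ b) (ha : a ∈ x.carrier) : b ∈ x.carrier := by
  rw [← sup_eq_right.mpr h]
  exact (x.sup_mem a b).mpr (Or.inl ha)

theorem bot_notMem (x : Point B) : ⊥ ∉ x.carrier := fun h =>
  (x.compl_mem ⊥).mp (x.mem_of_le bot_le h) h

theorem exists_of_notMem_ideal {I : Order.Ideal B} {a : B} (ha : a ∉ I) :
    ∃ x : Point B, a ∈ x.carrier ∧ ∀ b ∈ I, b ∉ x.carrier := by
  obtain ⟨J, hJ, hIJ, hd⟩ := DistribLattice.prime_ideal_of_disjoint_filter_ideal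
    (F := Order.PFilter.principal a) (I := I) (Set.disjoint_left.mpr fun b hb hbI =>
      ha (I.lower (Order.PFilter.mem_principal.mp hb) hbI))
  refine ⟨⟨{b | b ∉ J}, fun b => ?_, fun b c => ?_⟩, fun h => ?_, fun b hb h => h (hIJ hb)⟩
  · exact ⟨fun h1 h2 => hJ.mem_or_compl_mem.elim h2 h1, fun h1 h2 => h1 fun h3 =>
      hJ.toIsProper.notMem_of_compl_mem h2 h3⟩
  · simp only [Set.mem_ofPred_eq, Order.Ideal.sup_mem_iff]
    tauto
  · exact Set.disjoint_left.mp hd (Order.PFilter.mem_principal.mpr le_rfl) h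

theorem exists_mem_notMem {a b : B} (h : ¬ a ≤ b) :
    ∃ x : Point B, a ∈ x.carrier ∧ b ∉ x.carrier := by
  obtain ⟨x, hx, hx'⟩ := exists_of_notMem_ideal (I := Order.Ideal.principal b) (a := a)
    (by simpa using h)
  exact ⟨x, hx, hx' b (by simp)⟩

/-- The accessibility relation of the dual space. -/
def Rel (x y : Point B) : Prop := ∀ a ∈ y.carrier, dia a ∈ x.carrier

theorem Rel.trans {x y z : Point B} (h : Rel x y) (h' : Rel y z) : Rel x z := fun a ha =>
  x.mem_of_le (dia_dia_le a) (h _ (h' a ha))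

/-- Jónsson–Tarski: by additivity of `◇`, the `b` with `◇b ∉ x` form an ideal, and a prime filter
avoiding it is a successor of `x`. -/
theorem dia_mem_iff (x : Point B) (a : B) :
    dia a ∈ x.carrier ↔ ∃ y, Rel x y ∧ a ∈ y.carrier := by
  refine ⟨fun h => ?_, fun ⟨y, hxy, hy⟩ => hxy a hy⟩
  let I : Order.Ideal B :=
    { carrier := {b | dia b ∉ x.carrier}
      lower' := fun b c hcb hb hc => hb (x.mem_of_le (dia_mono hcb) hc)
      nonempty' := ⟨⊥, by simpa [dia_bot] using x.bot_notMem⟩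
      directed' := fun b hb c hc => ⟨b ⊔ c, by
        simp only [Set.mem_ofPred_eq, dia_sup, x.sup_mem] at hb hc ⊢
        tauto, le_sup_left, le_sup_right⟩ }
  obtain ⟨y, hy, hy'⟩ := exists_of_notMem_ideal (I := I) (a := a) (fun h' => h' h)
  exact ⟨y, fun b hb => by_contra fun hb' => hy' b hb' hb, hy⟩

/-- `y` is accessible from `x` but not conversely. -/
def Above (x y : Point B) : Prop := Rel x y ∧ ¬ Rel y x

/-- `x` and `y` lie in the same cluster. -/
def SameCluster (x y : Point B) : Prop := Rel x y ∧ Rel y x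

theorem SameCluster.above_iff {x y z : Point B} (h : SameCluster x y) :
    Above x z ↔ Above y z :=
  ⟨fun h' => ⟨h.2.trans h'.1, fun h2 => h'.2 (h2.trans h.2)⟩,
    fun h' => ⟨h.1.trans h'.1, fun h2 => h'.2 (h2.trans h.1)⟩⟩

theorem SameCluster.sameCluster_iff {x y z : Point B} (h : SameCluster x y) :
    SameCluster x z ↔ SameCluster y z :=
  ⟨fun h' => ⟨h.2.trans h'.1, h'.2.trans h.1⟩, fun h' => ⟨h.1.trans h'.1, h'.2.trans h.2⟩⟩

/-- Every strict chain starting at `x` has at most `n` points. -/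
def DepthLE : ℕ → Point B → Prop
  | 0, _ => False
  | n + 1, x => ∀ y, Above x y → DepthLE n y

theorem exists_box_mem_of_above {x y : Point B} (h : Above x y) :
    ∃ a, box a ∈ y.carrier ∧ box a ∉ x.carrier := by
  obtain ⟨b, hb⟩ := not_forall.mp h.2
  obtain ⟨hb, hb'⟩ := Classical.not_imp.mp hb
  refine ⟨bᶜ, ?_, ?_⟩
  · rwa [box, compl_compl, y.compl_mem]
  · rw [box, compl_compl, x.compl_mem, not_not]
    exact x.mem_of_le (le_dia b) hb

theorem refutation_congr {q q' : ℕ → B} {n : ℕ} (h : ∀ i ≤ n, q i = q' i) :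
    refutation q n = refutation q' n := by
  induction n with
  | zero => rfl
  | succ n ih => simp only [refutation, ih (fun i hi => h i (by omega)), h (n + 1) le_rfl]

/-- The valuation is built down a strict chain from its top, each strict step being witnessed by a
box true above and false below. -/
theorem exists_refutation_mem {n : ℕ} {x : Point B} (h : ¬ DepthLE n x) :
    ∃ q : ℕ → B, refutation q n ∈ x.carrier := by
  induction n generalizing x with
  | zero => exact ⟨fun _ => ⊥, by
      have := (x.compl_mem ⊥).mpr x.bot_notMem
      rwa [compl_bot] at this⟩
  | succ n ih =>
    simp only [DepthLE, not_forall] at h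
    obtain ⟨y, hxy, hy⟩ := h
    obtain ⟨q, hq⟩ := ih hy
    obtain ⟨a, hay, hax⟩ := exists_box_mem_of_above hxy
    -- `refutation q n` reads only the values of `q` up to `n`, so position `n + 1` is free.
    refine ⟨Function.update q (n + 1) a, ?_⟩
    rw [refutation, refutation_congr (q' := q), Function.update_self, x.inf_mem, x.compl_mem]
    · exact ⟨hxy.1 _ ((y.inf_mem _ _).mpr ⟨hay, hq⟩), hax⟩
    · intro i hi
      rw [Function.update_of_ne (by omega)]

theorem depthLE_of_validatesDepth {k : ℕ} (h : ValidatesDepth B k) (x : Point B) :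
    DepthLE (k + 1) x := by
  by_contra hx
  obtain ⟨q, hq⟩ := exists_refutation_mem hx
  rw [← compl_depthFormula, h q, compl_top] at hq
  exact x.bot_notMem hq

end Point

/-- The types of points over `m` generators, up to stage `j`: the colour of a point, the set of
colours in its cluster and the set of types of the points strictly above it. -/
def PointType (m : ℕ) : ℕ → Type
  | 0 => Unit
  | j + 1 => Set (Fin m) × Set (Set (Fin m)) × Set (PointType m j)

instance PointType.instFinite (m j : ℕ) : Finite (PointType m j) := by
  induction j with
  | zero => exact inferInstanceAs (Finite Unit)
  | succ j ih => exact inferInstanceAs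
      (Finite (Set (Fin m) × Set (Set (Fin m)) × Set (PointType m j)))

namespace Point

variable {B : Type u} [S4Algebra B] {m : ℕ} (g : Fin m → B)

/-- The set of generators true at `x`. -/
def color (x : Point B) : Set (Fin m) := {i | g i ∈ x.carrier}

/-- The type of a point. -/
def type : (j : ℕ) → Point B → PointType m j
  | 0, _ => ()
  | j + 1, x => (color g x, color g '' {y | SameCluster x y}, type j '' {y | Above x y})

theorem type_succ_eq_iff {j : ℕ} {x y : Point B} :
    type g (j + 1) x = type g (j + 1) y ↔ color g x = color g y ∧
      color g '' {z | SameCluster x z} = color g '' {z | SameCluster y z} ∧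
      type g j '' {z | Above x z} = type g j '' {z | Above y z} := by
  simp only [type]
  exact Prod.ext_iff.trans (and_congr_right fun _ => Prod.ext_iff)

/-- Types stabilise at the depth of the point; bounding the depth of one of the two points suffices.
-/
theorem type_succ_eq_of_depthLE {j : ℕ} {x y : Point B} (hx : DepthLE j x)
    (h : type g j x = type g j y) : type g (j + 1) x = type g (j + 1) y := by
  induction j generalizing x y with
  | zero => exact hx.elim
  | succ j ih =>
    obtain ⟨h1, h2, h3⟩ := (type_succ_eq_iff g).mp h
    refine (type_succ_eq_iff g).mpr ⟨h1, h2, Set.Subset.antisymm ?_ ?_⟩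
    · rintro _ ⟨z, hz, rfl⟩
      obtain ⟨w, hw, hwz⟩ := h3.subset ⟨z, hz, rfl⟩
      exact ⟨w, hw, (ih (hx z hz) hwz.symm).symm⟩
    · rintro _ ⟨w, hw, rfl⟩
      obtain ⟨z, hz, hwz⟩ := h3.superset ⟨w, hw, rfl⟩
      exact ⟨z, hz, ih (hx z hz) hwz⟩

/-- Equality of types is a bisimulation. A successor in the cluster of `x` is matched by colour,
since cluster mates share the other two components. A strict successor has depth at most `j`, so its
match at stage `j` lifts to stage `j + 1`. -/
theorem exists_rel_of_type_eq {j : ℕ} {x y z : Point B} (hx : DepthLE (j + 1) x)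
    (h : type g (j + 1) x = type g (j + 1) y) (hxz : Rel x z) :
    ∃ w, Rel y w ∧ type g (j + 1) z = type g (j + 1) w := by
  obtain ⟨-, h2, h3⟩ := (type_succ_eq_iff g).mp h
  by_cases hzx : Rel z x
  · obtain ⟨w, hw, hwz⟩ := h2.subset ⟨z, ⟨hxz, hzx⟩, rfl⟩
    refine ⟨w, hw.1, (type_succ_eq_iff g).mpr ⟨hwz.symm, ?_, ?_⟩⟩
    · have hz : SameCluster x z := ⟨hxz, hzx⟩
      have hw : SameCluster y w := hw
      simpa only [hz.sameCluster_iff, hw.sameCluster_iff] using h2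
    · have hz : SameCluster x z := ⟨hxz, hzx⟩
      have hw : SameCluster y w := hw
      simpa only [hz.above_iff, hw.above_iff] using h3
  · obtain ⟨w, hw, hwz⟩ := h3.subset ⟨z, ⟨hxz, hzx⟩, rfl⟩
    exact ⟨w, hw.1, type_succ_eq_of_depthLE g (hx z ⟨hxz, hzx⟩) hwz.symm⟩

/-- The elements that do not separate points of equal type form a subalgebra containing the
generators, hence are all of `B`. -/
theorem type_injective {j : ℕ} (hd : ∀ x : Point B, DepthLE (j + 1) x)
    (hg : ∀ a : B, a ∈ S4Subalgebra.closure (Set.range g)) :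
    Function.Injective (type g (j + 1) : Point B → _) := by
  let S : S4Subalgebra B :=
    { carrier := {a | ∀ x y : Point B, type g (j + 1) x = type g (j + 1) y →
        (a ∈ x.carrier ↔ a ∈ y.carrier)}
      supClosed' := fun a ha b hb x y h => by rw [x.sup_mem, y.sup_mem, ha x y h, hb x y h]
      infClosed' := fun a ha b hb x y h => by rw [x.inf_mem, y.inf_mem, ha x y h, hb x y h]
      compl_mem' := fun {a} ha x y h => by rw [x.compl_mem, y.compl_mem, ha x y h]
      bot_mem' := fun x y _ => iff_of_false x.bot_notMem y.bot_notMem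
      dia_mem' := fun {a} ha => by
        have key : ∀ x y : Point B, type g (j + 1) x = type g (j + 1) y →
            dia a ∈ x.carrier → dia a ∈ y.carrier := by
          intro x y h hax
          obtain ⟨z, hxz, hz⟩ := (x.dia_mem_iff a).mp hax
          obtain ⟨w, hyw, hw⟩ := exists_rel_of_type_eq g (hd x) h hxz
          exact (y.dia_mem_iff a).mpr ⟨w, hyw, (ha z w hw).mp hz⟩
        exact fun x y h => ⟨key x y h, key y x h.symm⟩ }
  intro x y h
  ext a
  refine hg a S ?_ x y h
  rintro _ ⟨i, rfl⟩ x y h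
  exact Set.ext_iff.mp ((type_succ_eq_iff g).mp h).1 i

end Point

/-- The uniform bound for `m`-generated `S4`-algebras validating `P_(k+1)`. -/
noncomputable def depthBound (k m : ℕ) : ℕ := Nat.card (Set (PointType m (k + 1)))

/-- **Segerberg–Maksimova**: `S4`-algebras of bounded depth are uniformly locally finite. -/
theorem finite_and_card_le_of_validatesDepth {B : Type u} [S4Algebra B] {k m : ℕ}
    (hk : ValidatesDepth B k) (hm : IsGeneratedBy B m) :
    Finite B ∧ Nat.card B ≤ depthBound k m := by
  obtain ⟨g, hg⟩ := hm
  have hinj := Point.type_injective g (Point.depthLE_of_validatesDepth hk) hg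
  let F : B → Set (PointType m (k + 1)) := fun a =>
    Point.type g (k + 1) '' {x : Point B | a ∈ x.carrier}
  have hF : Function.Injective F := by
    have hle : ∀ a b : B, F a = F b → a ≤ b := by
      intro a b h
      by_contra hab
      obtain ⟨x, hxa, hxb⟩ := Point.exists_mem_notMem hab
      have h' := hinj.image_injective h
      exact hxb (h'.subset hxa)
    exact fun a b h => le_antisymm (hle a b h) (hle b a h.symm)
  exact ⟨Finite.of_injective F hF, Nat.card_le_card_of_injective F hF⟩

end S4Algebra

/-! ### Quotients and Birkhoff's subdirect representation -/

namespace MS4Congruence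

variable {A : Type u} [MS4Algebra A]

/-- The quotient of an `MS4`-algebra by a congruence. -/
def QuotientAlgebra (c : MS4Congruence A) : Type u := Quotient c.toSetoid

variable (c : MS4Congruence A)

/-- The canonical projection. -/
def proj (a : A) : c.QuotientAlgebra := Quotient.mk c.toSetoid a

theorem proj_eq_proj {a b : A} : c.proj a = c.proj b ↔ c.r a b := Quotient.eq

theorem proj_surjective : Function.Surjective c.proj := Quotient.mk_surjective

instance : Max c.QuotientAlgebra :=
  ⟨Quotient.map₂ (· ⊔ ·) fun _ _ h _ _ h' => c.sup' h h'⟩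

instance : Min c.QuotientAlgebra :=
  ⟨Quotient.map₂ (· ⊓ ·) fun _ _ h _ _ h' => c.inf' h h'⟩

instance : Lattice c.QuotientAlgebra :=
  Lattice.mk'
    (by
      rintro ⟨a⟩ ⟨b⟩
      exact congrArg c.proj (sup_comm a b))
    (by
      rintro ⟨a⟩ ⟨b⟩ ⟨d⟩
      exact congrArg c.proj (sup_assoc a b d))
    (by
      rintro ⟨a⟩ ⟨b⟩
      exact congrArg c.proj (inf_comm a b))
    (by
      rintro ⟨a⟩ ⟨b⟩ ⟨d⟩
      exact congrArg c.proj (inf_assoc a b d))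
    (by
      rintro ⟨a⟩ ⟨b⟩
      exact congrArg c.proj (sup_inf_self (a := a) (b := b)))
    (by
      rintro ⟨a⟩ ⟨b⟩
      exact congrArg c.proj (inf_sup_self (a := a) (b := b)))

theorem proj_mono {a b : A} (h : a ≤ b) : c.proj a ≤ c.proj b :=
  sup_eq_right.mp (congrArg c.proj (sup_eq_right.mpr h))

instance : BooleanAlgebra c.QuotientAlgebra where
  le_sup_inf := by
    rintro ⟨x⟩ ⟨y⟩ ⟨z⟩
    exact c.proj_mono (le_sup_inf (x := x) (y := y) (z := z))
  compl := Quotient.map (·ᶜ) fun _ _ h => c.compl' h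
  top := c.proj ⊤
  bot := c.proj ⊥
  inf_compl_le_bot := by
    rintro ⟨x⟩
    exact c.proj_mono (BooleanAlgebra.inf_compl_le_bot x)
  top_le_sup_compl := by
    rintro ⟨x⟩
    exact c.proj_mono (BooleanAlgebra.top_le_sup_compl x)
  le_top := by
    rintro ⟨x⟩
    exact c.proj_mono le_top
  bot_le := by
    rintro ⟨x⟩
    exact c.proj_mono bot_le

instance : MS4Algebra c.QuotientAlgebra where
  dia := Quotient.map S4Algebra.dia fun _ _ h => c.dia' h
  dia_bot := congrArg c.proj S4Algebra.dia_bot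
  dia_sup := by
    rintro ⟨a⟩ ⟨b⟩
    exact congrArg c.proj (S4Algebra.dia_sup a b)
  le_dia := by
    rintro ⟨a⟩
    exact c.proj_mono (S4Algebra.le_dia a)
  dia_dia_le := by
    rintro ⟨a⟩
    exact c.proj_mono (S4Algebra.dia_dia_le a)
  ex := Quotient.map MS4Algebra.ex fun _ _ h => c.ex' h
  ex_bot := congrArg c.proj MS4Algebra.ex_bot
  ex_sup := by
    rintro ⟨a⟩ ⟨b⟩
    exact congrArg c.proj (MS4Algebra.ex_sup a b)
  le_ex := by
    rintro ⟨a⟩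
    exact c.proj_mono (MS4Algebra.le_ex a)
  ex_ex_le := by
    rintro ⟨a⟩
    exact c.proj_mono (MS4Algebra.ex_ex_le a)
  ex_all_le := by
    rintro ⟨a⟩
    exact c.proj_mono (MS4Algebra.ex_all_le a)
  ex_dia_le := by
    rintro ⟨a⟩
    exact c.proj_mono (MS4Algebra.ex_dia_le a)

/-- The canonical projection as a homomorphism. -/
def projHom : MS4Hom A c.QuotientAlgebra where
  toFun := c.proj
  map_sup' _ _ := rfl
  map_inf' _ _ := rfl
  map_top' := rfl
  map_bot' := rfl
  map_dia' _ := rfl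
  map_ex' _ := rfl

/-- The preimage of a congruence of the quotient. -/
def comapProj (d : MS4Congruence c.QuotientAlgebra) : MS4Congruence A where
  toSetoid := d.toSetoid.comap c.proj
  sup' h h' := d.sup' h h'
  inf' h h' := d.inf' h h'
  compl' h := d.compl' h
  dia' h := d.dia' h
  ex' h := d.ex' h

/-- The intersection of a set of congruences. -/
def sInf (C : Set (MS4Congruence A)) : MS4Congruence A where
  r a b := ∀ d ∈ C, d.r a b
  iseqv := ⟨fun a d _ => d.iseqv.refl a, fun h d hd => d.iseqv.symm (h d hd),
    fun h h' d hd => d.iseqv.trans (h d hd) (h' d hd)⟩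
  sup' h h' d hd := d.sup' (h d hd) (h' d hd)
  inf' h h' d hd := d.inf' (h d hd) (h' d hd)
  compl' h d hd := d.compl' (h d hd)
  dia' h d hd := d.dia' (h d hd)
  ex' h d hd := d.ex' (h d hd)

/-- The identity congruence. -/
def identity (A : Type u) [MS4Algebra A] : MS4Congruence A where
  r a b := a = b
  iseqv := eq_equivalence
  sup' h h' := by rw [h, h']
  inf' h h' := by rw [h, h']
  compl' h := by rw [h]
  dia' h := by rw [h]
  ex' h := by rw [h]

instance : Preorder (MS4Congruence A) := Preorder.lift MS4Congruence.toSetoid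

theorem exists_rel_and_rel_of_isChain {C : Set (MS4Congruence A)} (hC : IsChain (· ≤ ·) C)
    {a b a' b' : A} (h : ∃ d ∈ C, d.r a b) (h' : ∃ d ∈ C, d.r a' b') :
    ∃ d ∈ C, d.r a b ∧ d.r a' b' := by
  obtain ⟨d, hd, h⟩ := h
  obtain ⟨d', hd', h'⟩ := h'
  rcases hC.total hd hd' with hle | hle
  · exact ⟨d', hd', hle h, h'⟩
  · exact ⟨d, hd, h, hle h'⟩

/-- The union of a nonempty chain of congruences. -/
def chainUnion (C : Set (MS4Congruence A)) (hC : IsChain (· ≤ ·) C) (hne : C.Nonempty) :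
    MS4Congruence A where
  r a b := ∃ d ∈ C, d.r a b
  iseqv := ⟨fun a => ⟨hne.some, hne.some_mem, hne.some.iseqv.refl a⟩,
    fun ⟨d, hd, h⟩ => ⟨d, hd, d.iseqv.symm h⟩, fun h h' => by
      obtain ⟨d, hd, h, h'⟩ := exists_rel_and_rel_of_isChain hC h h'
      exact ⟨d, hd, d.iseqv.trans h h'⟩⟩
  sup' h h' := by
    obtain ⟨d, hd, h, h'⟩ := exists_rel_and_rel_of_isChain hC h h'
    exact ⟨d, hd, d.sup' h h'⟩
  inf' h h' := by
    obtain ⟨d, hd, h, h'⟩ := exists_rel_and_rel_of_isChain hC h h'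
    exact ⟨d, hd, d.inf' h h'⟩
  compl' := fun ⟨d, hd, h⟩ => ⟨d, hd, d.compl' h⟩
  dia' := fun ⟨d, hd, h⟩ => ⟨d, hd, d.dia' h⟩
  ex' := fun ⟨d, hd, h⟩ => ⟨d, hd, d.ex' h⟩

/-- **Birkhoff**: distinct elements are separated by a congruence whose quotient is
subdirectly irreducible. -/
theorem exists_isSubdirectlyIrreducible_quotient {a b : A} (hab : a ≠ b) :
    ∃ c : MS4Congruence A, ¬ c.r a b ∧
      MS4Algebra.IsSubdirectlyIrreducible c.QuotientAlgebra := by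
  obtain ⟨c, -, hc⟩ := zorn_le_nonempty₀ {c : MS4Congruence A | ¬ c.r a b}
    (fun C hCs hC y hy => ⟨chainUnion C hC ⟨y, hy⟩, fun ⟨d, hd, h⟩ => hCs hd h,
      fun d hd _ _ h => ⟨d, hd, h⟩⟩) (identity A) hab
  refine ⟨c, hc.prop, ?_⟩
  -- As `c` is maximal among congruences separating `a` and `b`, every nontrivial congruence of the
  -- quotient identifies their images; so does the intersection of all of these, which is therefore
  -- nontrivial.
  have key : ∀ d : MS4Congruence c.QuotientAlgebra, d.toSetoid ≠ ⊥ → d.r (c.proj a) (c.proj b) := by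
    intro d hd
    by_contra hdab
    have hle : c ≤ c.comapProj d := fun x y h => by
      change d.r (c.proj x) (c.proj y)
      rw [c.proj_eq_proj.mpr h]
    have hge := hc.le_of_ge (y := c.comapProj d) hdab hle
    refine hd (le_bot_iff.mp ?_)
    intro x y h
    obtain ⟨x, rfl⟩ := c.proj_surjective x
    obtain ⟨y, rfl⟩ := c.proj_surjective y
    exact c.proj_eq_proj.mpr (hge h)
  refine ⟨sInf {d | d.toSetoid ≠ ⊥}, fun h => ?_, fun d hd x y h => h d hd⟩
  have h1 : (sInf {d : MS4Congruence c.QuotientAlgebra | d.toSetoid ≠ ⊥}).r (c.proj a) (c.proj b) :=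
    fun d hd => key d hd
  have h2 : (⊥ : Setoid c.QuotientAlgebra) (c.proj a) (c.proj b) := h ▸ h1
  exact hc.prop (c.proj_eq_proj.mp h2)

end MS4Congruence

/-! ### Finiteness from bounded subdirectly irreducible quotients -/

namespace MS4Algebra

theorem IsGeneratedBy.quotient {A : Type u} [MS4Algebra A] {n : ℕ} (h : IsGeneratedBy A n)
    (c : MS4Congruence A) : IsGeneratedBy c.QuotientAlgebra n := by
  obtain ⟨g, hg⟩ := h
  refine ⟨c.proj ∘ g, fun x => ?_⟩
  obtain ⟨a, rfl⟩ := c.proj_surjective x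
  intro S hS
  let T : MS4Subalgebra A :=
    { carrier := c.proj ⁻¹' S
      supClosed' := fun _ ha _ hb => S.supClosed' ha hb
      infClosed' := fun _ ha _ hb => S.infClosed' ha hb
      compl_mem' := fun ha => S.compl_mem' ha
      bot_mem' := S.bot_mem'
      dia_mem' := fun ha => S.dia_mem' ha
      ex_mem' := fun ha => S.ex_mem' ha }
  refine hg a T ?_
  rintro _ ⟨i, rfl⟩
  exact hS ⟨i, rfl⟩

/-- Operations of the type of `MS4`-algebras, with `n` constants for generators, on `Fin N`. -/
abbrev FinData (n N : ℕ) : Type :=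
  (Fin N → Fin N → Fin N) × (Fin N → Fin N → Fin N) × (Fin N → Fin N) × Fin N ×
    (Fin N → Fin N) × (Fin N → Fin N) × (Fin n → Fin N)

/-- The map `φ` is a homomorphism for the operations `D`, and maps generators to constants. -/
structure Compatible {A : Type u} [MS4Algebra A] {n N : ℕ} (g : Fin n → A) (D : FinData n N)
    (φ : A → Fin N) : Prop where
  map_sup : ∀ a b, φ (a ⊔ b) = D.1 (φ a) (φ b)
  map_inf : ∀ a b, φ (a ⊓ b) = D.2.1 (φ a) (φ b)
  map_compl : ∀ a, φ aᶜ = D.2.2.1 (φ a)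
  map_bot : φ ⊥ = D.2.2.2.1
  map_dia : ∀ a, φ (S4Algebra.dia a) = D.2.2.2.2.1 (φ a)
  map_ex : ∀ a, φ (ex a) = D.2.2.2.2.2.1 (φ a)
  map_gen : ∀ i, φ (g i) = D.2.2.2.2.2.2 i

theorem Compatible.unique {A : Type u} [MS4Algebra A] {n N : ℕ} {g : Fin n → A}
    (hg : ∀ a : A, a ∈ MS4Subalgebra.closure (Set.range g)) {D : FinData n N}
    {φ ψ : A → Fin N} (h : Compatible g D φ) (h' : Compatible g D ψ) : φ = ψ := by
  let T : MS4Subalgebra A :=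
    { carrier := {a | φ a = ψ a}
      supClosed' := fun a (ha : _ = _) b (hb : _ = _) =>
        show _ = _ by rw [h.map_sup, h'.map_sup, ha, hb]
      infClosed' := fun a (ha : _ = _) b (hb : _ = _) =>
        show _ = _ by rw [h.map_inf, h'.map_inf, ha, hb]
      compl_mem' := fun {a} (ha : _ = _) => show _ = _ by rw [h.map_compl, h'.map_compl, ha]
      bot_mem' := show _ = _ by rw [h.map_bot, h'.map_bot]
      dia_mem' := fun {a} (ha : _ = _) => show _ = _ by rw [h.map_dia, h'.map_dia, ha]
      ex_mem' := fun {a} (ha : _ = _) => show _ = _ by rw [h.map_ex, h'.map_ex, ha] }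
  refine funext fun a => hg a T ?_
  rintro _ ⟨i, rfl⟩
  exact (h.map_gen i).trans (h'.map_gen i).symm

/-- The quotient is copied into `Fin N`; indices outside the copy get arbitrary values through
`Function.invFun`. -/
theorem exists_compatible {A : Type u} [MS4Algebra A] {n N : ℕ} (g : Fin n → A)
    (c : MS4Congruence A) [Finite c.QuotientAlgebra] (hN : Nat.card c.QuotientAlgebra ≤ N) :
    ∃ (D : FinData n N) (φ : A → Fin N), Compatible g D φ ∧ ∀ a b, φ a = φ b → c.r a b := by
  let e : c.QuotientAlgebra → Fin N := fun x => Fin.castLE hN (Finite.equivFin _ x)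
  have he : Function.Injective e := fun x y h =>
    (Finite.equivFin _).injective (Fin.castLE_injective hN h)
  have : Nonempty c.QuotientAlgebra := ⟨⊥⟩
  let s : Fin N → c.QuotientAlgebra := Function.invFun e
  have hs : ∀ x, s (e x) = x := Function.leftInverse_invFun he
  refine ⟨⟨fun i j => e (s i ⊔ s j), fun i j => e (s i ⊓ s j), fun i => e (s i)ᶜ, e ⊥,
    fun i => e (S4Algebra.dia (s i)), fun i => e (ex (s i)), fun i => e (c.proj (g i))⟩,
    e ∘ c.proj, ?_, fun a b h => c.proj_eq_proj.mp (he h)⟩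
  constructor <;> intros <;> simp only [Function.comp_apply, hs] <;> rfl

/-- A finitely generated algebra all of whose subdirectly irreducible quotients have size
at most `N` is finite. -/
theorem finite_of_forall_quotient {A : Type u} [MS4Algebra A] {n N : ℕ} (h : IsGeneratedBy A n)
    (hN : ∀ c : MS4Congruence A, IsSubdirectlyIrreducible c.QuotientAlgebra →
      Finite c.QuotientAlgebra ∧ Nat.card c.QuotientAlgebra ≤ N) : Finite A := by
  obtain ⟨g, hg⟩ := h
  -- There are finitely many `D`, each with at most one compatible map. An element is determined by
  -- its values under these maps, which lie in a finite set.
  have hev : Function.Injective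
      (fun (a : A) (D : FinData n N) (i : Fin N) => ∃ φ, Compatible g D φ ∧ φ a = i) := by
    intro a b h
    by_contra hab
    obtain ⟨c, hc, hsi⟩ := MS4Congruence.exists_isSubdirectlyIrreducible_quotient hab
    obtain ⟨hfin, hcard⟩ := hN c hsi
    obtain ⟨D, φ, hφ, hφc⟩ := exists_compatible g c hcard
    obtain ⟨ψ, hψ, hψb⟩ := (congrFun (congrFun h D) (φ a)).mp ⟨φ, hφ, rfl⟩
    rw [hψ.unique hg hφ] at hψb
    exact hc (hφc a b hψb.symm)
  exact Finite.of_injective _ hev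

end MS4Algebra

/-! ### Transfer to subalgebras, `S4`-reducts and products -/

namespace S4Algebra

theorem ValidatesDepth.sub {B : Type u} [S4Algebra B] {k : ℕ} (h : ValidatesDepth B k)
    (S : S4Subalgebra B) : ValidatesDepth S k := by
  intro q
  have key : ∀ n, ((depthFormula q n : S) : B) = depthFormula (fun i => (q i : B)) n := by
    intro n
    induction n with
    | zero => rfl
    | succ n ih =>
      rw [depthFormula, depthFormula, ← ih]
      rfl
  exact Subtype.ext ((key k).trans (h _))

end S4Algebra

namespace MS4Algebra

theorem mem_closure_of_mem {A : Type u} [MS4Algebra A] {s : Set A} {a : A} (h : a ∈ s) :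
    a ∈ MS4Subalgebra.closure s := fun _ hS => hS h

/-- An algebra generated by `n` elements is generated as an `S4`-algebra by these and any
enumeration of its `∃`-fixpoints. -/
theorem IsGeneratedBy.s4 {A : Type u} [MS4Algebra A] {n : ℕ} (h : IsGeneratedBy A n)
    [Finite (exFixpoints A)] :
    S4Algebra.IsGeneratedBy A (n + Nat.card (exFixpoints A)) := by
  obtain ⟨g, hg⟩ := h
  let e : Fin (Nat.card (exFixpoints A)) → A := fun i => ((Finite.equivFin _).symm i).1
  refine ⟨Fin.append g e, fun a S hS => ?_⟩
  -- Values of `∃` are fixpoints, hence among the listed generators; thus any such `S` is already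
  -- closed under `∃`.
  have hex : ∀ b : A, ex b ∈ S := fun b => by
    have hb : ex b ∈ exFixpoints A := le_antisymm (ex_ex_le b) (le_ex _)
    refine hS ⟨Fin.natAdd n (Finite.equivFin _ ⟨ex b, hb⟩), ?_⟩
    simp [e]
  let T : MS4Subalgebra A := { S with ex_mem' := fun {b} _ => hex b }
  refine hg a T ?_
  rintro _ ⟨i, rfl⟩
  exact hS ⟨Fin.castAdd _ i, Fin.append_left g e i⟩

/-- The subalgebra generated by a finite set is a finitely generated algebra. -/
theorem isGeneratedBy_closure {A : Type u} [MS4Algebra A] {s : Set A} (hs : s.Finite) :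
    ∃ n, IsGeneratedBy (MS4Subalgebra.closure s) n := by
  have := hs.to_subtype
  let e := Finite.equivFin s
  refine ⟨_, fun i => ⟨(e.symm i).1, mem_closure_of_mem (e.symm i).2⟩, fun ⟨a, ha⟩ S hS => ?_⟩
  let T : MS4Subalgebra A :=
    { carrier := {b | ∃ h : b ∈ MS4Subalgebra.closure s, (⟨b, h⟩ : MS4Subalgebra.closure s) ∈ S}
      supClosed' := fun _ ⟨_, ha⟩ _ ⟨_, hb⟩ => ⟨_, S.supClosed' ha hb⟩
      infClosed' := fun _ ⟨_, ha⟩ _ ⟨_, hb⟩ => ⟨_, S.infClosed' ha hb⟩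
      compl_mem' := fun ⟨_, ha⟩ => ⟨_, S.compl_mem' ha⟩
      bot_mem' := ⟨_, S.bot_mem'⟩
      dia_mem' := fun ⟨_, ha⟩ => ⟨_, S.dia_mem' ha⟩
      ex_mem' := fun ⟨_, ha⟩ => ⟨_, S.ex_mem' ha⟩ }
  refine (ha T fun b hb => ⟨mem_closure_of_mem hb, hS ⟨e ⟨b, hb⟩, ?_⟩⟩).2
  exact Subtype.ext (show (e.symm (e ⟨b, hb⟩)).1 = b by rw [e.symm_apply_apply])

/-- In a product, the subalgebra generated by a tuple projects onto every factor that is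
generated by the corresponding coordinates. -/
theorem exists_mem_closure_apply_eq {I : Type u} {A : I → Type u} [∀ i, MS4Algebra (A i)] {n : ℕ}
    (g : Fin n → ∀ i, A i) {i : I}
    (hg : ∀ a : A i, a ∈ MS4Subalgebra.closure (Set.range fun j => g j i)) (a : A i) :
    ∃ x ∈ MS4Subalgebra.closure (Set.range g), x i = a := by
  let C := MS4Subalgebra.closure (Set.range g)
  let T : MS4Subalgebra (A i) :=
    { carrier := {a | ∃ x ∈ C, x i = a}
      supClosed' := fun _ ⟨x, hx, h⟩ _ ⟨y, hy, h'⟩ => ⟨x ⊔ y, C.supClosed' hx hy, h ▸ h' ▸ rfl⟩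
      infClosed' := fun _ ⟨x, hx, h⟩ _ ⟨y, hy, h'⟩ => ⟨x ⊓ y, C.infClosed' hx hy, h ▸ h' ▸ rfl⟩
      compl_mem' := fun ⟨x, hx, h⟩ => ⟨xᶜ, C.compl_mem' hx, h ▸ rfl⟩
      bot_mem' := ⟨⊥, C.bot_mem', rfl⟩
      dia_mem' := fun ⟨x, hx, h⟩ => ⟨_, C.dia_mem' hx, h ▸ rfl⟩
      ex_mem' := fun ⟨x, hx, h⟩ => ⟨_, C.ex_mem' hx, h ▸ rfl⟩ }
  refine hg a T ?_
  rintro _ ⟨j, rfl⟩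
  exact ⟨g j, mem_closure_of_mem ⟨j, rfl⟩, rfl⟩

theorem alternatingBox_mem {A : Type u} [MS4Algebra A] (S : MS4Subalgebra A) {a : A} (ha : a ∈ S)
    (n : ℕ) : S4Algebra.alternatingBox a n ∈ S := by
  induction n with
  | zero => exact S.bot_mem'
  | succ n ih =>
    refine S.compl_mem' (S.dia_mem' (S.compl_mem' (S.supClosed' ih ?_)))
    rw [S4Algebra.parityElement]
    split_ifs
    · exact ha
    · exact S.compl_mem' ha

theorem alternatingBox_apply {I : Type u} {A : I → Type u} [∀ i, MS4Algebra (A i)]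
    (a : ∀ i, A i) (n : ℕ) (i : I) :
    S4Algebra.alternatingBox a n i = S4Algebra.alternatingBox (a i) n := by
  induction n with
  | zero => rfl
  | succ n ih =>
    rw [S4Algebra.alternatingBox, S4Algebra.alternatingBox, ← ih, S4Algebra.parityElement,
      S4Algebra.parityElement]
    split_ifs <;> rfl

end MS4Algebra

/-! ### Consequences of local finiteness -/

namespace MS4Variety

variable {V : MS4Variety.{u}}

theorem IsLocallyFinite.hasFiniteDepth (hV : V.IsLocallyFinite) : V.HasFiniteDepth := by
  by_contra hd
  simp only [HasFiniteDepth, not_exists, not_forall] at hd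
  choose A instA hA hAd using hd
  choose a ha using fun k => S4Algebra.exists_alternatingBox_ne (hAd k)
  let b : ∀ k : ULift.{u} ℕ, A k.down := fun k => a k.down
  have hfin := hV _ (V.prod (ULift.{u} ℕ) (fun k => A k.down) fun k => hA k.down) {b}
    (Set.finite_singleton b)
  have : ¬ Function.Injective (S4Algebra.alternatingBox b) := fun hinj =>
    Set.infinite_of_injective_forall_mem hinj
      (MS4Algebra.alternatingBox_mem _ (MS4Algebra.mem_closure_of_mem (Set.mem_singleton b))) hfin
  have hmono := S4Algebra.alternatingBox_monotone b
  obtain ⟨n, m, h, hnm⟩ : ∃ n m,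
      S4Algebra.alternatingBox b n = S4Algebra.alternatingBox b m ∧ n < m := by
    simp only [Function.Injective, not_forall] at this
    obtain ⟨n, m, h, hne⟩ := this
    rcases lt_or_gt_of_ne hne with hlt | hlt
    · exact ⟨n, m, h, hlt⟩
    · exact ⟨m, n, h.symm, hlt⟩
  have h1 : S4Algebra.alternatingBox b n = S4Algebra.alternatingBox b (n + 1) :=
    le_antisymm (hmono n.le_succ) ((hmono hnm).trans_eq h.symm)
  have h2 := congrFun h1 (ULift.up n)
  rw [MS4Algebra.alternatingBox_apply, MS4Algebra.alternatingBox_apply] at h2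
  exact ha n n le_rfl h2

/-- In a locally finite variety the sizes of the `n`-generated members are bounded. -/
theorem IsLocallyFinite.exists_card_le (hV : V.IsLocallyFinite) (n : ℕ) :
    ∃ N : ℕ, ∀ (A : Type u) [MS4Algebra A], V.Mem A → MS4Algebra.IsGeneratedBy A n →
      Finite A ∧ Nat.card A ≤ N := by
  by_contra hd
  simp only [not_exists, not_forall] at hd
  choose A instA hA hgen hbig using hd
  choose g hg using hgen
  let b : Fin n → ∀ k : ULift.{u} ℕ, A k.down := fun j k => g k.down j
  have hfin := hV _ (V.prod (ULift.{u} ℕ) (fun k => A k.down) fun k => hA k.down) (Set.range b)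
    (Set.finite_range b)
  let C := MS4Subalgebra.closure (Set.range b)
  have : Finite C := hfin
  have hsurj : Function.Surjective (fun x : C => x.1 (ULift.up (Nat.card C))) := fun a => by
    obtain ⟨x, hx, h⟩ := MS4Algebra.exists_mem_closure_apply_eq b
      (i := ULift.up (Nat.card C)) (hg (Nat.card C)) a
    exact ⟨⟨x, hx⟩, h⟩
  -- Diagonal choice: the factor violating the bound `Nat.card C` is an image of `C`.
  exact hbig (Nat.card C) ⟨Finite.of_surjective _ hsurj, Nat.card_le_card_of_surjective _ hsurj⟩

end MS4Variety

/-! ### Explicit size bounds and the equivalence -/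

theorem S4Algebra.isGeneratedBy_of_card_le {B : Type u} [S4Algebra B] [Finite B] {N : ℕ}
    (h : Nat.card B ≤ N) : S4Algebra.IsGeneratedBy B N := by
  let e : B → Fin N := fun x => Fin.castLE h (Finite.equivFin _ x)
  have he : Function.Injective e := fun x y hxy =>
    (Finite.equivFin _).injective (Fin.castLE_injective h hxy)
  have : Nonempty B := ⟨⊥⟩
  exact ⟨Function.invFun e, fun a S hS => hS ⟨e a, Function.leftInverse_invFun he a⟩⟩

/-- The bound for `n`-generated algebras validating `P_(k+1)` whose algebra of `∃`-fixpoints is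
`m`-generated. -/
noncomputable def MS4Algebra.sizeBound (k m n : ℕ) : ℕ :=
  -- Here `i` runs over the possible sizes of `A₀`; taking the supremum avoids any appeal to
  -- monotonicity of `depthBound`.
  (Finset.range (S4Algebra.depthBound k m + 1)).sup fun i => S4Algebra.depthBound k (n + i)

theorem MS4Algebra.finite_and_card_le {A : Type u} [MS4Algebra A] {k m n : ℕ}
    (hk : S4Algebra.ValidatesDepth A k)
    (hm : S4Algebra.IsGeneratedBy (MS4Algebra.exFixpoints A) m)
    (hn : MS4Algebra.IsGeneratedBy A n) :
    Finite A ∧ Nat.card A ≤ MS4Algebra.sizeBound k m n := by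
  obtain ⟨h1, h2⟩ := S4Algebra.finite_and_card_le_of_validatesDepth (hk.sub _) hm
  obtain ⟨h3, h4⟩ := S4Algebra.finite_and_card_le_of_validatesDepth hk hn.s4
  exact ⟨h3, h4.trans (Finset.le_sup (f := fun i => S4Algebra.depthBound k (n + i))
    (Finset.mem_range.mpr (Nat.lt_succ_of_le h2)))⟩

theorem mainTheorem5 (V : MS4Variety.{u}) :
    V.IsLocallyFinite ↔
      V.HasFiniteDepth ∧
      ∃ f : ℕ → ℕ, ∀ (n : ℕ) (A : Type u) [MS4Algebra A], V.Mem A →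
        MS4Algebra.IsSubdirectlyIrreducible A → MS4Algebra.IsGeneratedBy A n →
        S4Algebra.IsGeneratedBy (MS4Algebra.exFixpoints A) (f n) := by
  constructor
  · intro hV
    choose f hf using hV.exists_card_le
    refine ⟨hV.hasFiniteDepth, f, fun n A _ hA _ hgen => ?_⟩
    obtain ⟨hfin, hcard⟩ := hf n A hA hgen
    exact S4Algebra.isGeneratedBy_of_card_le
      ((Nat.card_le_card_of_injective _ Subtype.val_injective).trans hcard)
  · rintro ⟨⟨k, hk⟩, f, hf⟩ A _ hA s hs
    obtain ⟨n, hn⟩ := MS4Algebra.isGeneratedBy_closure hs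
    change Finite (MS4Subalgebra.closure s)
    refine MS4Algebra.finite_of_forall_quotient (N := MS4Algebra.sizeBound k (f n) n) hn fun c hc => ?_
    have hc' := V.image _ _ c.projHom c.proj_surjective (V.sub A _ hA)
    exact MS4Algebra.finite_and_card_le (hk _ hc')
      (hf n _ hc' hc (hn.quotient c)) (hn.quotient c)
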